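/- Setting. Let $G=(V,E)$ be a finite simple graph, $n=|V|$, with labels $[k]$. An instance $(G,c,w)$ of uniform metric labeling (MAP inference in a Potts model) has node costs $c(u,i)\in\mathbb R$ and edge weights $w(u,v)\ge 0$; the objective of a labeling $x:V\to[k]$ is $\sum_{u}c(u,x(u))+\sum_{uv\in E:\,x(u)\ne x(v)}w(u,v)$, and a MAP solution is a minimizing labeling. The local LP minimizes $\sum_{u,i}c(u,i)x_u(i)+\sum_{uv\in E}w(u,v)\sum_{i\ne j}x_{uv}(i,j)$ over variables in $[0,1]$ with $\sum_i x_u(i)=1$, $\sum_i x_{uv}(i,j)=x_v(j)$ and $\sum_j x_{uv}(i,j)=x_u(i)$. We write $x_V=(x_u(i))_{u,i}$ for the node part, and identify a labeling with its $0/1$ vector. An expansion of a labeling $x$ is a labeling $y\neq x$ such that for some label $i$ every vertex $u$ has $y(u)\in\{i,x(u)\}$. The instance $(G,c,w)$ is $(2,1)$-expansion stable if its MAP solution has strictly smaller objective than each of its expansions in $(G,c,w')$ for every $w'$ with $w/2\le w'\le w$. For $\psi>0$ it is $(2,1,\psi)$-expansion stable if $(G,c',w)$ is $(2,1)$-expansion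 stable for all $c'$ with $c\le c'\le c+\psi\cdot\mathbf 1$. A random variable $X$ is sub-Gaussian with parameter $\sigma$ if $\mathbb E\,e^{\lambda(X-\mathbb EX)}\le e^{\lambda^2\sigma^2/2}$ for all $\lambda\in\mathbb R$; it is $(b,\sigma)$-truncated sub-Gaussian if moreover it is supported in $(b,\infty)$. Statement. Let $G$ be $d$-regular, let $\psi>0$, and let $(G,\bar c,\bar w)$ be a $(2,1,\psi)$-expansion stable instance with MAP solution $\bar x$. Fix a set consisting of a $\rho$-fraction of the $nk$ node costs and a set consisting of an $\eta$-fraction of the $|E|$ edge weights. The observed instance is $(G,\hat c,\hat w)$ with $\hat c=\bar c+\tilde c$, $\hat w=\bar w+\tilde w$, where all the variables $\tilde c(u,i)$, $\tilde w(u,v)$ are independent; on the chosen costs $\tilde c(u,i)$ has mean zero and is sub-Gaussian with parameter $\sigma\ge 0$; on the chosen edges $\tilde w(u,v)$ has mean zero and is $(-\bar w(u,v),\gamma)$-truncated sub-Gaussian, $\gamma\ge0$; all other $\tilde c(u,i)$ and $\tilde w(u,v)$ are $0$. Then for every constant $c>\sqrt{\ln 2}$, with probability at least $1-2\exp\!\big(-nk(c^2-\ln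 2)\big)$, every solution $\hat x$ of the local LP of $(G,\hat c,\hat w)$ satisfies \[ \tfrac12\,\lVert \hat x_V-\bar x_V\rVert_1\;\le\;\frac{2cnk\,\sqrt{\rho\sigma^2+\frac{\eta dk}{8}\gamma^2}}{\psi}. \] -/

import Mathlib

open MeasureTheory ProbabilityTheory
open scoped NNReal

noncomputable section

namespace Potts

variable {V : Type*} [Fintype V] [DecidableEq V] {k : ℕ}

/-! ## Uniform metric labeling (MAP inference in a Potts model)

An instance is a finite simple graph `G`, node costs `c u i` (vertex `u`, label `i`) and edge
weights `w e`; only the values of `w` on the edges of `G` matter. -/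

/-- The objective of a labeling: node costs plus the total weight of the cut edges. An edge is cut
when its endpoints get different labels. -/
def objective (G : SimpleGraph V) [DecidableRel G.Adj] (c : V → Fin k → ℝ) (w : Sym2 V → ℝ)
    (x : V → Fin k) : ℝ :=
  ∑ u, c u (x u) + ∑ e ∈ G.edgeFinset, w e * (if (e.map x).IsDiag then 0 else 1)

/-- `x` is a MAP solution: a labeling of minimum objective. -/
def IsMAP (G : SimpleGraph V) [DecidableRel G.Adj] (c : V → Fin k → ℝ) (w : Sym2 V → ℝ)
    (x : V → Fin k) : Prop :=
  ∀ y : V → Fin k, objective G c w x ≤ objective G c w y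

/-! ## The local LP relaxation -/

/-- The variables of the local LP. The edge variable `x_{uv}(i,j)`, which is the same variable as
`x_{vu}(j,i)`, is `edge s((u, i), (v, j))`. -/
structure LocalPoint (V : Type*) (k : ℕ) where
  node : V → Fin k → ℝ
  edge : Sym2 (V × Fin k) → ℝ

/-- The total edge mass on pairs of distinct labels, `∑_{i ≠ j} x_{uv}(i,j)`. -/
def LocalPoint.cutMass (x : LocalPoint V k) : Sym2 V → ℝ :=
  Sym2.lift ⟨fun u v => ∑ i, ∑ j, if i = j then 0 else x.edge s((u, i), (v, j)), by
    intro u v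
    beta_reduce
    rw [Finset.sum_comm]
    refine Finset.sum_congr rfl fun i _ => Finset.sum_congr rfl fun j _ => ?_
    rw [Sym2.eq_swap]
    simp only [eq_comm]⟩

/-- The local polytope `L(G)`. Both families of marginalization constraints are contained in
`marginal`, because it ranges over both orientations of every edge. -/
structure LocalPoint.Feasible (G : SimpleGraph V) (x : LocalPoint V k) : Prop where
  normalized : ∀ u, ∑ i, x.node u i = 1
  marginal : ∀ u v, G.Adj u v → ∀ j, ∑ i, x.edge s((u, i), (v, j)) = x.node v j
  edge_mem : ∀ u v, G.Adj u v → ∀ i j, x.edge s((u, i), (v, j)) ∈ Set.Icc (0 : ℝ) 1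
  node_mem : ∀ u i, x.node u i ∈ Set.Icc (0 : ℝ) 1

/-- The objective `⟨θ, x⟩`, `θ = (c, w)`, of the local LP. -/
def lpObjective (G : SimpleGraph V) [DecidableRel G.Adj] (c : V → Fin k → ℝ) (w : Sym2 V → ℝ)
    (x : LocalPoint V k) : ℝ :=
  ∑ u, ∑ i, c u i * x.node u i + ∑ e ∈ G.edgeFinset, w e * x.cutMass e

/-- `x` is a solution of the local LP: it minimizes the objective over `L(G)`. -/
def IsLPSolution (G : SimpleGraph V) [DecidableRel G.Adj] (c : V → Fin k → ℝ) (w : Sym2 V → ℝ)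
    (x : LocalPoint V k) : Prop :=
  x.Feasible G ∧ ∀ y : LocalPoint V k, y.Feasible G → lpObjective G c w x ≤ lpObjective G c w y

/-- The `0/1` node vector of a labeling. -/
def nodeVector (x : V → Fin k) : V → Fin k → ℝ := fun u i => if x u = i then 1 else 0

/-- The `ℓ₁` distance of two node vectors. -/
def l1Dist (a b : V → Fin k → ℝ) : ℝ := ∑ u, ∑ i, |a u i - b u i|

/-! ## Expansion stability -/

/-- `y` is an expansion of `x`: `y ≠ x` arises from `x` by switching some vertices to one common
label. -/
def IsExpansion (x y : V → Fin k) : Prop :=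
  y ≠ x ∧ ∃ i : Fin k, ∀ u, y u = i ∨ y u = x u

/-- `w'` is a `(2,1)`-perturbation of `w`. -/
def IsPerturbation (G : SimpleGraph V) (w w' : Sym2 V → ℝ) : Prop :=
  ∀ e ∈ G.edgeSet, w e / 2 ≤ w' e ∧ w' e ≤ w e

/-- `(2,1)`-expansion stability: the MAP solution is strictly better than each of its expansions
in every `(2,1)`-perturbation of the instance. -/
def ExpansionStable (G : SimpleGraph V) [DecidableRel G.Adj] (c : V → Fin k → ℝ)
    (w : Sym2 V → ℝ) : Prop :=
  ∃ x : V → Fin k, IsMAP G c w x ∧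
    ∀ w', IsPerturbation G w w' → ∀ y, IsExpansion x y → objective G c w' x < objective G c w' y

/-- `(2,1,ψ)`-expansion stability: `(G, c', w)` is `(2,1)`-expansion stable whenever
`c ≤ c' ≤ c + ψ` entrywise. -/
def PsiExpansionStable (G : SimpleGraph V) [DecidableRel G.Adj] (c : V → Fin k → ℝ)
    (w : Sym2 V → ℝ) (ψ : ℝ) : Prop :=
  ∀ c' : V → Fin k → ℝ, (∀ u i, c u i ≤ c' u i ∧ c' u i ≤ c u i + ψ) → ExpansionStable G c' w

/-! ## The generative model -/

variable {Ω : Type*} [MeasurableSpace Ω]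

/-- `X` is sub-Gaussian with parameter `σ`: `E exp(t (X - E X)) ≤ exp(t² σ² / 2)` for all `t`. -/
def SubGaussian (X : Ω → ℝ) (σ : ℝ≥0) (P : Measure Ω) : Prop :=
  HasSubgaussianMGF (fun ω => X ω - ∫ ω', X ω' ∂P) (σ ^ 2) P

/-- `X` is `(b, σ)`-truncated sub-Gaussian: supported in `(b, ∞)` and sub-Gaussian with
parameter `σ`. -/
def TruncatedSubGaussian (X : Ω → ℝ) (b : ℝ) (σ : ℝ≥0) (P : Measure Ω) : Prop :=
  (∀ᵐ ω ∂P, b < X ω) ∧ SubGaussian X σ P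

/-- The noise of the generative model. The observed instance is `(c + cn, w + wn)`, with `(c, w)`
the latent instance. All noise variables are independent; the node costs in `N` carry mean-zero
sub-Gaussian noise with parameter `σ`, the edge weights in `M` carry mean-zero truncated
sub-Gaussian noise with parameter `γ` that keeps the observed weight positive, and the other
costs and weights carry no noise. -/
structure NoiseModel (G : SimpleGraph V) (w : Sym2 V → ℝ)
    (N : Finset (V × Fin k)) (M : Finset (Sym2 V)) (σ γ : ℝ≥0)
    (P : Measure Ω) (cn : V → Fin k → Ω → ℝ) (wn : Sym2 V → Ω → ℝ) : Prop where
  indep : iIndepFun (β := fun _ => ℝ)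
    (fun j : (V × Fin k) ⊕ G.edgeSet =>
      Sum.elim (fun p : V × Fin k => cn p.1 p.2) (fun e : G.edgeSet => wn e) j) P
  cost_mean : ∀ u i, (u, i) ∈ N → ∫ ω, cn u i ω ∂P = 0
  cost_subGaussian : ∀ u i, (u, i) ∈ N → SubGaussian (cn u i) σ P
  cost_clean : ∀ u i, (u, i) ∉ N → ∀ᵐ ω ∂P, cn u i ω = 0
  weight_mean : ∀ e ∈ M, ∫ ω, wn e ω ∂P = 0
  weight_subGaussian : ∀ e ∈ M, TruncatedSubGaussian (wn e) (-w e) γ P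
  weight_clean : ∀ e ∈ G.edgeSet, e ∉ M → ∀ᵐ ω ∂P, wn e ω = 0

end Potts

end

namespace Potts

variable {V : Type*} {k : ℕ}

/-! For nonnegative weights, optimizing the edge variables reduces the local LP to a function F of
the node vector: linear node costs plus weighted uniform distances. Thresholding each coordinate at
a common uniform level writes a node vector z as a mixture of 0/1 vectors along which F averages
exactly, whatever the signs of the weights (`IsThresholdMixture.sum_relaxedObjective`).

Stability gives tightness. Expanding x by each label on the superlevel sets of z, and summing over
labels, costs on average at most F(z) - F(x), measured in the perturbation that halves the weights
of edges uncut by x (`IsThresholdMixture.sum_objective_expand_le`). No expansion is an improvement,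
so F(x) ≤ F(z).

Stability with margin ψ gives curvature. The MAP solution survives raising its own label costs by ψ
(`PsiExpansionStable.isMAP_raise`), and tightness of the raised instance says F(z) - F(x) ≥ ψ · ½‖z
- x‖₁.

For an observed LP solution z, optimality forces the noise part of F to favour z over x by at least
this amount. By averaging, some 0/1 vector, not necessarily a labeling, gains as much. There are
2^(nk) such vectors and each gain is sub-Gaussian, so a union bound finishes. -/

/-- The uniform distance `½ ∑ i, |z u i - z v i|` of the label distributions at the two ends of
an edge. -/
noncomputable def labelDist (z : V → Fin k → ℝ) : Sym2 V → ℝ :=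
  Sym2.lift ⟨fun u v => 1 / 2 * ∑ i, |z u i - z v i|, fun u v => by simp only [abs_sub_comm]⟩

/-- The indicator of the event that an edge is cut by a labeling. -/
noncomputable def cut (x : V → Fin k) (e : Sym2 V) : ℝ := if (e.map x).IsDiag then 0 else 1

lemma labelDist_mk (z : V → Fin k → ℝ) (u v : V) :
    labelDist z s(u, v) = 1 / 2 * ∑ i, |z u i - z v i| := rfl

lemma cut_mk (x : V → Fin k) (u v : V) : cut x s(u, v) = if x u = x v then 0 else 1 := by
  simp [cut]

lemma labelDist_nodeVector (x : V → Fin k) (e : Sym2 V) : labelDist (nodeVector x) e = cut x e := by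
  induction e with | _ u v
  rw [labelDist_mk, cut_mk]
  simp only [nodeVector]
  by_cases h : x u = x v
  · simp [h]
  · rw [if_neg h]
    have : ∀ i : Fin k, |(if x u = i then (1 : ℝ) else 0) - (if x v = i then 1 else 0)|
        = (if x u = i then 1 else 0) + (if x v = i then 1 else 0) := by
      intro i
      by_cases h1 : x u = i <;> by_cases h2 : x v = i
      · exact absurd (h1.trans h2.symm) h
      all_goals simp [h1, h2]
    simp only [this, Finset.sum_add_distrib, Finset.sum_ite_eq, Finset.mem_univ, if_true]
    norm_num

open Classical in
/-- The integral point of the local polytope given by a labeling. -/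
noncomputable def integralPoint (x : V → Fin k) : LocalPoint V k where
  node := nodeVector x
  edge := fun e => if ∀ p ∈ e, x p.1 = p.2 then 1 else 0

lemma integralPoint_edge (x : V → Fin k) (u v : V) (i j : Fin k) :
    (integralPoint x).edge s((u, i), (v, j)) =
      if x u = i then (if x v = j then 1 else 0) else 0 := by
  simp only [integralPoint, Sym2.mem_iff, forall_eq_or_imp, forall_eq]
  split_ifs <;> simp_all

/-! ### The local polytope -/

/-- The coupling inequality for total variation: summing by rows or by columns, the off-diagonal
mass is a marginal minus the diagonal. Both differences are nonnegative in each coordinate, so their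
sum dominates the absolute difference of the marginals. -/
lemma LocalPoint.Feasible.labelDist_le_cutMass {G : SimpleGraph V} {x : LocalPoint V k}
    (hx : x.Feasible G) {e : Sym2 V} (he : e ∈ G.edgeSet) : labelDist x.node e ≤ x.cutMass e := by
  induction e with | _ u v
  have huv : G.Adj u v := he
  rw [labelDist_mk]
  change _ ≤ ∑ i, ∑ j, if i = j then 0 else x.edge s((u, i), (v, j))
  have off : ∀ f : Fin k → ℝ, ∀ i, ∑ j, (if i = j then 0 else f j) = ∑ j, f j - f i := by
    intro f i
    have h : ∑ j, (if i = j then f j else 0) = f i := by simp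
    rw [eq_sub_iff_add_eq, ← h, ← Finset.sum_add_distrib]
    exact Finset.sum_congr rfl fun j _ => by split_ifs <;> simp
  have row : ∀ i, ∑ j, x.edge s((u, i), (v, j)) = x.node u i := by
    intro i
    rw [← hx.marginal v u huv.symm i]
    exact Finset.sum_congr rfl fun j _ => by rw [Sym2.eq_swap]
  have col := hx.marginal u v huv
  have h1 : ∑ i, ∑ j, (if i = j then 0 else x.edge s((u, i), (v, j))) =
      ∑ i, (x.node u i - x.edge s((u, i), (v, i))) :=
    Finset.sum_congr rfl fun i _ => by rw [off, row]
  have h2 : ∑ i, ∑ j, (if i = j then 0 else x.edge s((u, i), (v, j))) =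
      ∑ i, (x.node v i - x.edge s((u, i), (v, i))) := by
    rw [Finset.sum_comm]
    refine Finset.sum_congr rfl fun j _ => ?_
    rw [← col j, ← off (fun i => x.edge s((u, i), (v, j))) j]
    exact Finset.sum_congr rfl fun i _ => by simp only [eq_comm]
  have h3 : ∑ i, |x.node u i - x.node v i| ≤
      ∑ i, (x.node u i - x.edge s((u, i), (v, i))) + ∑ i, (x.node v i - x.edge s((u, i), (v, i))) := by
    rw [← Finset.sum_add_distrib]
    refine Finset.sum_le_sum fun i _ => ?_
    have e1 : x.edge s((u, i), (v, i)) ≤ x.node u i := by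
      rw [← row i]
      exact Finset.single_le_sum (f := fun j => x.edge s((u, i), (v, j)))
        (fun j _ => (hx.edge_mem u v huv i j).1) (Finset.mem_univ i)
    have e2 : x.edge s((u, i), (v, i)) ≤ x.node v i := by
      rw [← col i]
      exact Finset.single_le_sum (f := fun j => x.edge s((u, j), (v, i)))
        (fun j _ => (hx.edge_mem u v huv j i).1) (Finset.mem_univ i)
    rw [abs_le]
    constructor <;> linarith
  linarith

lemma integralPoint_feasible (G : SimpleGraph V) (x : V → Fin k) :
    (integralPoint x).Feasible G where
  normalized u := by simp [integralPoint, nodeVector]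
  marginal u v _ j := by simp [integralPoint_edge]; rfl
  edge_mem u v _ i j := by
    rw [integralPoint_edge]
    split_ifs <;> simp
  node_mem u i := by
    change (if x u = i then (1 : ℝ) else 0) ∈ _
    split_ifs <;> simp

/-! ### The local LP with the edge variables eliminated. -/

section Fintype

variable [Fintype V]

/-- The objective of the local LP after minimizing over the edge variables (for nonnegative
weights), as a function of the node variables. -/
noncomputable def relaxedObjective (G : SimpleGraph V) [DecidableRel G.Adj] (c : V → Fin k → ℝ)
    (w : Sym2 V → ℝ) (z : V → Fin k → ℝ) : ℝ :=
  ∑ u, ∑ i, c u i * z u i + ∑ e ∈ G.edgeFinset, w e * labelDist z e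

lemma objective_eq (G : SimpleGraph V) [DecidableRel G.Adj] (c : V → Fin k → ℝ) (w : Sym2 V → ℝ)
    (x : V → Fin k) :
    objective G c w x = ∑ u, c u (x u) + ∑ e ∈ G.edgeFinset, w e * cut x e := rfl

lemma relaxedObjective_nodeVector (G : SimpleGraph V) [DecidableRel G.Adj] (c : V → Fin k → ℝ)
    (w : Sym2 V → ℝ) (x : V → Fin k) :
    relaxedObjective G c w (nodeVector x) = objective G c w x := by
  rw [objective_eq, relaxedObjective]
  simp only [labelDist_nodeVector]
  simp [nodeVector]

lemma relaxedObjective_add (G : SimpleGraph V) [DecidableRel G.Adj] (c c' : V → Fin k → ℝ)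
    (w w' : Sym2 V → ℝ) (z : V → Fin k → ℝ) :
    relaxedObjective G (fun u i => c u i + c' u i) (fun e => w e + w' e) z =
      relaxedObjective G c w z + relaxedObjective G c' w' z := by
  simp only [relaxedObjective, add_mul, Finset.sum_add_distrib]
  ring

lemma LocalPoint.Feasible.relaxedObjective_le {G : SimpleGraph V} [DecidableRel G.Adj]
    {x : LocalPoint V k} (hx : x.Feasible G) (c : V → Fin k → ℝ) {w : Sym2 V → ℝ}
    (hw : ∀ e ∈ G.edgeSet, 0 ≤ w e) : relaxedObjective G c w x.node ≤ lpObjective G c w x := by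
  refine add_le_add le_rfl (Finset.sum_le_sum fun e he => ?_)
  rw [SimpleGraph.mem_edgeFinset] at he
  exact mul_le_mul_of_nonneg_left (hx.labelDist_le_cutMass he) (hw e he)

lemma lpObjective_integralPoint (G : SimpleGraph V) [DecidableRel G.Adj] (c : V → Fin k → ℝ)
    (w : Sym2 V → ℝ) (x : V → Fin k) :
    lpObjective G c w (integralPoint x) = objective G c w x := by
  rw [← relaxedObjective_nodeVector]
  unfold lpObjective relaxedObjective
  congr 1
  refine Finset.sum_congr rfl fun e _ => ?_
  rw [labelDist_nodeVector]
  congr 1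
  induction e with | _ u v
  change (∑ i, ∑ j, if i = j then 0 else (integralPoint x).edge s((u, i), (v, j))) = _
  rw [cut_mk, Finset.sum_eq_single (x u), Finset.sum_eq_single (x v)]
  · simp [integralPoint_edge]
  · intro j _ hj
    simp [integralPoint_edge, hj.symm]
  · simp
  · intro i _ hi
    simp [integralPoint_edge, hi.symm]
  · simp

end Fintype

/-! ### Threshold decomposition -/

/-- `μ` is a probability distribution on sets which contains two points jointly with probability
the minimum of their coordinates in `z`, as do the superlevel sets of `z` at a uniform threshold. -/
structure IsThresholdMixture {ι : Type*} [Fintype ι] [DecidableEq ι] (z : ι → ℝ)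
    (μ : Finset ι → ℝ) : Prop where
  nonneg : ∀ S, 0 ≤ μ S
  sum_eq_one : ∑ S, μ S = 1
  sum_pair : ∀ p q, ∑ S, μ S * (if p ∈ S ∧ q ∈ S then 1 else 0) = min (z p) (z q)

/-- The weight of S is the length of the set of thresholds in [0, 1) whose superlevel set is S. Two
points lie in that set together exactly when the threshold is below both coordinates. -/
lemma exists_isThresholdMixture {ι : Type*} [Fintype ι] [DecidableEq ι] (z : ι → ℝ)
    (hz : ∀ p, z p ∈ Set.Icc (0 : ℝ) 1) : ∃ μ, IsThresholdMixture z μ := by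
  classical
  let T : ℝ → Finset ι := fun t => Finset.univ.filter fun p => t < z p
  let m : Measure ℝ := volume.restrict (Set.Ico 0 1)
  have : IsProbabilityMeasure m := ⟨by simp [m]⟩
  have hmeas : ∀ S, MeasurableSet (T ⁻¹' {S}) := by
    intro S
    have : T ⁻¹' {S} = ⋂ p, {t | t < z p ↔ p ∈ S} := by
      ext t
      simp [T, Finset.ext_iff]
    rw [this]
    refine MeasurableSet.iInter fun p => ?_
    by_cases hp : p ∈ S
    · simp only [hp, iff_true]
      exact measurableSet_Iio
    · simp only [hp, iff_false, not_lt]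
      exact measurableSet_Ici
  have key : ∀ A : Set (Finset ι), ∑ S, m.real (T ⁻¹' {S}) * (if S ∈ A then 1 else 0) =
      m.real (T ⁻¹' A) := by
    intro A
    have hA : T ⁻¹' A = ⋃ S ∈ Finset.univ.filter (· ∈ A), T ⁻¹' {S} := by
      ext t
      simp
    rw [hA, measureReal_biUnion_finset, Finset.sum_filter]
    · simp
    · intro S _ S' _ h
      exact Disjoint.preimage _ (by simpa using h)
    · exact fun S _ => hmeas S
  refine ⟨fun S => m.real (T ⁻¹' {S}), fun S => measureReal_nonneg, ?_, fun p q => ?_⟩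
  · have := key Set.univ
    simpa using this
  · have h1 : ∑ S, m.real (T ⁻¹' {S}) * (if p ∈ S ∧ q ∈ S then 1 else 0) =
        m.real (T ⁻¹' {S | p ∈ S ∧ q ∈ S}) := by
      rw [← key]
      exact Finset.sum_congr rfl fun S _ => by
        simp only [Set.mem_ofPred_eq]
        congr
    rw [h1]
    have h2 : T ⁻¹' {S | p ∈ S ∧ q ∈ S} = Set.Iio (min (z p) (z q)) := by
      ext t
      simp [T]
    have h3 : Set.Iio (min (z p) (z q)) ∩ Set.Ico 0 1 = Set.Ico 0 (min (z p) (z q)) := by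
      ext t
      simp only [Set.mem_inter_iff, Set.mem_Iio, Set.mem_Ico]
      exact ⟨fun h => ⟨h.2.1, h.1⟩, fun h => ⟨h.2, h.1, h.2.trans_le ((min_le_left _ _).trans (hz p).2)⟩⟩
    rw [h2, measureReal_def, Measure.restrict_apply measurableSet_Iio, h3, Real.volume_Ico, sub_zero,
      ENNReal.toReal_ofReal (le_min (hz p).1 (hz q).1)]

lemma IsThresholdMixture.sum_mem {ι : Type*} [Fintype ι] [DecidableEq ι] {z : ι → ℝ}
    {μ : Finset ι → ℝ} (h : IsThresholdMixture z μ) (p : ι) :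
    ∑ S, μ S * (if p ∈ S then 1 else 0) = z p := by
  simpa using h.sum_pair p p

lemma IsThresholdMixture.sum_abs {ι : Type*} [Fintype ι] [DecidableEq ι] {z : ι → ℝ}
    {μ : Finset ι → ℝ} (h : IsThresholdMixture z μ) (p q : ι) :
    ∑ S, μ S * |(if p ∈ S then (1 : ℝ) else 0) - (if q ∈ S then 1 else 0)| = |z p - z q| := by
  have h1 : ∀ S : Finset ι, μ S * |(if p ∈ S then (1 : ℝ) else 0) - (if q ∈ S then 1 else 0)| =
      μ S * (if p ∈ S then 1 else 0) + μ S * (if q ∈ S then 1 else 0)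
        - 2 * (μ S * (if p ∈ S ∧ q ∈ S then 1 else 0)) := by
    intro S
    by_cases hp : p ∈ S <;> by_cases hq : q ∈ S <;> simp [hp, hq]; ring
  simp only [h1, Finset.sum_sub_distrib, Finset.sum_add_distrib, ← Finset.mul_sum, h.sum_mem,
    h.sum_pair]
  rcases le_total (z p) (z q) with hle | hle
  · rw [min_eq_left hle, abs_of_nonpos (by linarith)]; ring
  · rw [min_eq_right hle, abs_of_nonneg (by linarith)]; ring

section SetVector

variable [DecidableEq V]

/-- The `0/1` node vector of a set of (vertex, label) pairs. -/
noncomputable def setVector (S : Finset (V × Fin k)) : V → Fin k → ℝ :=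
  fun u i => if (u, i) ∈ S then 1 else 0

variable [Fintype V]

/-- Superlevel sets are nested, so even absolute differences average exactly. Since this is an
equality, the weights may have any sign, as is needed for the noise. -/
lemma IsThresholdMixture.sum_relaxedObjective {z : V → Fin k → ℝ} {μ : Finset (V × Fin k) → ℝ}
    (h : IsThresholdMixture (fun p : V × Fin k => z p.1 p.2) μ) (G : SimpleGraph V)
    [DecidableRel G.Adj] (c : V → Fin k → ℝ) (w : Sym2 V → ℝ) :
    ∑ S, μ S * relaxedObjective G c w (setVector S) = relaxedObjective G c w z := by
  have hd : ∀ e, ∑ S, μ S * labelDist (setVector S) e = labelDist z e := by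
    intro e
    induction e with | _ u v
    simp only [labelDist_mk, Finset.mul_sum]
    rw [Finset.sum_comm]
    refine Finset.sum_congr rfl fun i _ => ?_
    rw [← h.sum_abs (u, i) (v, i), Finset.mul_sum]
    exact Finset.sum_congr rfl fun S _ => by simp only [setVector]; ring
  simp only [relaxedObjective, mul_add, Finset.sum_add_distrib, Finset.mul_sum]
  congr 1
  · rw [Finset.sum_comm]
    refine Finset.sum_congr rfl fun u _ => ?_
    rw [Finset.sum_comm]
    refine Finset.sum_congr rfl fun i _ => ?_
    rw [← h.sum_mem (u, i), Finset.mul_sum]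
    exact Finset.sum_congr rfl fun S _ => by simp only [setVector]; ring
  · rw [Finset.sum_comm]
    refine Finset.sum_congr rfl fun e _ => ?_
    rw [← hd e, Finset.mul_sum]
    exact Finset.sum_congr rfl fun S _ => by ring

end SetVector

/-! ### Stable instances have tight relaxations -/

/-- The labeling that agrees with `x` except that vertices `u` with `(u, i) ∈ S` get label `i`. -/
def expand [DecidableEq V] (x : V → Fin k) (S : Finset (V × Fin k)) (i : Fin k) : V → Fin k :=
  fun u => if (u, i) ∈ S then i else x u

lemma isExpansion_expand [DecidableEq V] {x : V → Fin k} {S : Finset (V × Fin k)} {i : Fin k} (h : expand x S i ≠ x) :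
    IsExpansion x (expand x S i) :=
  ⟨h, i, fun u => by unfold expand; split_ifs <;> simp⟩

/-- The `(2,1)`-perturbation of `w` that is worst for `x`: it halves the weights of uncut edges. -/
noncomputable def worstWeight (w : Sym2 V → ℝ) (x : V → Fin k) : Sym2 V → ℝ :=
  fun e => w e * ((1 + cut x e) / 2)

lemma isPerturbation_worstWeight {G : SimpleGraph V} {w : Sym2 V → ℝ}
    (hw : ∀ e ∈ G.edgeSet, 0 ≤ w e) (x : V → Fin k) : IsPerturbation G w (worstWeight w x) := by
  intro e he
  have := hw e he
  unfold worstWeight cut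
  split_ifs <;> constructor <;> linarith

section Expansion

variable [Fintype V] [DecidableEq V]

/-- Averaging over labels and thresholds, the cut indicators of the expansions are bounded by the
uniform distance. -/
lemma IsThresholdMixture.sum_cut_expand_le {z : V → Fin k → ℝ} {μ : Finset (V × Fin k) → ℝ}
    (h : IsThresholdMixture (fun p : V × Fin k => z p.1 p.2) μ) (hz1 : ∀ u, ∑ i, z u i = 1)
    (x : V → Fin k) (e : Sym2 V) :
    (1 + cut x e) / 2 * ∑ S, μ S * ∑ i, (cut (expand x S i) e - cut x e) ≤
      labelDist z e - cut x e := by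
  induction e with | _ u v
  have hmin : labelDist z s(u, v) = 1 - ∑ i, min (z u i) (z v i) := by
    have : ∀ i, |z u i - z v i| = z u i + z v i - 2 * min (z u i) (z v i) := by
      intro i
      rcases le_total (z u i) (z v i) with hle | hle
      · rw [min_eq_left hle, abs_of_nonpos (by linarith)]; ring
      · rw [min_eq_right hle, abs_of_nonneg (by linarith)]; ring
    rw [labelDist_mk]
    simp only [this, Finset.sum_sub_distrib, Finset.sum_add_distrib, hz1, ← Finset.mul_sum]
    ring
  have hpair : ∑ S, μ S * ∑ i, (if (u, i) ∈ S ∧ (v, i) ∈ S then (1 : ℝ) else 0) =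
      ∑ i, min (z u i) (z v i) := by
    simp only [Finset.mul_sum]
    rw [Finset.sum_comm]
    exact Finset.sum_congr rfl fun i _ => h.sum_pair (u, i) (v, i)
  have hone : ∀ u, ∑ S, μ S * ∑ i, (if (u, i) ∈ S then (1 : ℝ) else 0) = 1 := by
    intro u
    simp only [Finset.mul_sum]
    rw [Finset.sum_comm]
    refine Eq.trans ?_ (hz1 u)
    exact Finset.sum_congr rfl fun i _ => h.sum_mem (u, i)
  -- An uncut edge can become cut only when exactly one endpoint is switched. Over all labels this
  -- has total weight ∑ |z u i - z v i|, twice the uniform distance; the halved edge weight absorbs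
  -- the 2.
  by_cases huv : x u = x v
  · have hb : ∑ S, μ S * ∑ i, (cut (expand x S i) s(u, v) - cut x s(u, v)) ≤
        ∑ S, μ S * ∑ i, ((if (u, i) ∈ S then (1 : ℝ) else 0) + (if (v, i) ∈ S then 1 else 0)
          - 2 * (if (u, i) ∈ S ∧ (v, i) ∈ S then 1 else 0)) := by
      refine Finset.sum_le_sum fun S _ => mul_le_mul_of_nonneg_left
        (Finset.sum_le_sum fun i _ => ?_) (h.nonneg S)
      rw [cut_mk, cut_mk, if_pos huv]
      unfold expand
      by_cases h1 : (u, i) ∈ S <;> by_cases h2 : (v, i) ∈ S <;> simp [h1, h2, huv]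
      · norm_num
      all_goals split_ifs <;> norm_num
    simp only [Finset.sum_sub_distrib, Finset.sum_add_distrib, mul_sub, mul_add, hone,
      ← Finset.mul_sum, mul_left_comm _ (2 : ℝ), hpair] at hb
    have hc : cut x s(u, v) = 0 := by rw [cut_mk, if_pos huv]
    simp only [hc, hmin, Finset.sum_sub_distrib, mul_sub] at hb ⊢
    linarith
  -- A cut edge never gets worse and is healed whenever both endpoints are switched, with total
  -- weight ∑ min (z u i) (z v i), which is 1 minus the uniform distance.
  · have hb : ∑ S, μ S * ∑ i, (cut (expand x S i) s(u, v) - cut x s(u, v)) ≤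
        ∑ S, μ S * ∑ i, (-(if (u, i) ∈ S ∧ (v, i) ∈ S then (1 : ℝ) else 0)) := by
      refine Finset.sum_le_sum fun S _ => mul_le_mul_of_nonneg_left
        (Finset.sum_le_sum fun i _ => ?_) (h.nonneg S)
      rw [cut_mk, cut_mk, if_neg huv]
      unfold expand
      by_cases h1 : (u, i) ∈ S <;> by_cases h2 : (v, i) ∈ S <;> simp [h1, h2]
      all_goals split_ifs <;> norm_num
    simp only [Finset.sum_neg_distrib, mul_neg, hpair] at hb
    have hc : cut x s(u, v) = 1 := by rw [cut_mk, if_neg huv]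
    simp only [hc, hmin] at hb ⊢
    linarith

/-- The node costs balance exactly, because u is switched to i with weight z u i and these weights
sum to 1. The edges are bounded one at a time by `IsThresholdMixture.sum_cut_expand_le`. -/
lemma IsThresholdMixture.sum_objective_expand_le {z : V → Fin k → ℝ}
    {μ : Finset (V × Fin k) → ℝ} (h : IsThresholdMixture (fun p : V × Fin k => z p.1 p.2) μ)
    (hz1 : ∀ u, ∑ i, z u i = 1) (G : SimpleGraph V) [DecidableRel G.Adj] (c : V → Fin k → ℝ)
    {w : Sym2 V → ℝ} (hw : ∀ e ∈ G.edgeSet, 0 ≤ w e) (x : V → Fin k) :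
    ∑ S, μ S * ∑ i, (objective G c (worstWeight w x) (expand x S i)
        - objective G c (worstWeight w x) x) ≤
      relaxedObjective G c w z - objective G c w x := by
  have hnode : ∑ S, μ S * ∑ i, ∑ u, (c u (expand x S i u) - c u (x u)) =
      ∑ u, ∑ i, c u i * z u i - ∑ u, c u (x u) := by
    have h1 : ∀ S i u, c u (expand x S i u) - c u (x u) =
        (c u i - c u (x u)) * (if (u, i) ∈ S then 1 else 0) := by
      intro S i u
      unfold expand
      split_ifs <;> simp
    simp only [h1, Finset.mul_sum]
    rw [Finset.sum_comm, ← Finset.sum_sub_distrib, Finset.sum_congr rfl fun i _ => Finset.sum_comm,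
      Finset.sum_comm]
    refine Finset.sum_congr rfl fun u _ => ?_
    have h2 : ∑ i, c u i * z u i - c u (x u) = ∑ i, (c u i - c u (x u)) * z u i := by
      simp only [sub_mul, Finset.sum_sub_distrib, ← Finset.mul_sum, hz1, mul_one]
    rw [h2]
    refine Finset.sum_congr rfl fun i _ => ?_
    rw [← h.sum_mem (u, i), Finset.mul_sum]
    exact Finset.sum_congr rfl fun S _ => by ring
  have hedge : ∑ S, μ S * ∑ i, ∑ e ∈ G.edgeFinset, worstWeight w x e *
        (cut (expand x S i) e - cut x e) ≤
      ∑ e ∈ G.edgeFinset, w e * (labelDist z e - cut x e) := by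
    have h1 : ∑ S, μ S * ∑ i, ∑ e ∈ G.edgeFinset, worstWeight w x e *
        (cut (expand x S i) e - cut x e) = ∑ e ∈ G.edgeFinset, w e * ((1 + cut x e) / 2 *
          ∑ S, μ S * ∑ i, (cut (expand x S i) e - cut x e)) := by
      simp only [Finset.mul_sum]
      rw [Finset.sum_congr rfl fun S _ => Finset.sum_comm, Finset.sum_comm]
      refine Finset.sum_congr rfl fun e _ => Finset.sum_congr rfl fun S _ =>
        Finset.sum_congr rfl fun i _ => ?_
      unfold worstWeight
      ring
    rw [h1]
    refine Finset.sum_le_sum fun e he => mul_le_mul_of_nonneg_left (h.sum_cut_expand_le hz1 x e) ?_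
    exact hw e (SimpleGraph.mem_edgeFinset.1 he)
  have hsplit : ∀ S i, objective G c (worstWeight w x) (expand x S i)
        - objective G c (worstWeight w x) x =
      ∑ u, (c u (expand x S i u) - c u (x u)) +
        ∑ e ∈ G.edgeFinset, worstWeight w x e * (cut (expand x S i) e - cut x e) := by
    intro S i
    simp only [objective_eq, mul_sub, Finset.sum_sub_distrib]
    ring
  simp only [hsplit, Finset.sum_add_distrib, mul_add, hnode] at hedge ⊢
  simp only [mul_sub, Finset.sum_sub_distrib (s := G.edgeFinset)] at hedge
  rw [objective_eq, relaxedObjective]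
  simp only [mul_sub, Finset.sum_sub_distrib] at hedge ⊢
  linarith

/-- A labeling that is strictly better than its expansions in every `(2,1)`-perturbation. -/
def BeatsExpansions (G : SimpleGraph V) [DecidableRel G.Adj] (c : V → Fin k → ℝ)
    (w : Sym2 V → ℝ) (x : V → Fin k) : Prop :=
  ∀ w', IsPerturbation G w w' → ∀ y, IsExpansion x y → objective G c w' x < objective G c w' y

section Tight

variable {G : SimpleGraph V} [DecidableRel G.Adj] {c : V → Fin k → ℝ} {w : Sym2 V → ℝ}
  {x : V → Fin k}

lemma BeatsExpansions.le_expand (hx : BeatsExpansions G c w x) (hw : ∀ e ∈ G.edgeSet, 0 ≤ w e)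
    (S : Finset (V × Fin k)) (i : Fin k) :
    0 ≤ objective G c (worstWeight w x) (expand x S i) - objective G c (worstWeight w x) x := by
  by_cases h : expand x S i = x
  · rw [h, sub_self]
  · exact sub_nonneg.2 (hx _ (isPerturbation_worstWeight hw x) _ (isExpansion_expand h)).le

lemma BeatsExpansions.objective_le (hx : BeatsExpansions G c w x)
    (hw : ∀ e ∈ G.edgeSet, 0 ≤ w e) {z : V → Fin k → ℝ} (hz : ∀ u i, z u i ∈ Set.Icc (0 : ℝ) 1)
    (hz1 : ∀ u, ∑ i, z u i = 1) : objective G c w x ≤ relaxedObjective G c w z := by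
  obtain ⟨μ, hμ⟩ := exists_isThresholdMixture (fun p : V × Fin k => z p.1 p.2) fun p => hz p.1 p.2
  refine sub_nonneg.1 ((Finset.sum_nonneg fun S _ => ?_).trans
    (hμ.sum_objective_expand_le hz1 G c hw x))
  exact mul_nonneg (hμ.nonneg S) (Finset.sum_nonneg fun i _ => hx.le_expand hw S i)

/-- Positive mass on a label other than that of x puts positive weight on a superlevel set whose
expansion differs from x, and stability makes that term strictly positive. -/
lemma BeatsExpansions.objective_lt (hx : BeatsExpansions G c w x)
    (hw : ∀ e ∈ G.edgeSet, 0 ≤ w e) {z : V → Fin k → ℝ} (hz : ∀ u i, z u i ∈ Set.Icc (0 : ℝ) 1)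
    (hz1 : ∀ u, ∑ i, z u i = 1) {u : V} {i : Fin k} (hi : i ≠ x u) (hpos : 0 < z u i) :
    objective G c w x < relaxedObjective G c w z := by
  obtain ⟨μ, hμ⟩ := exists_isThresholdMixture (fun p : V × Fin k => z p.1 p.2) fun p => hz p.1 p.2
  have hnn : ∀ S, 0 ≤ μ S * (if (u, i) ∈ S then (1 : ℝ) else 0) := fun S =>
    mul_nonneg (hμ.nonneg S) (by split_ifs <;> norm_num)
  obtain ⟨S, -, hS⟩ : ∃ S ∈ Finset.univ, 0 < μ S * (if (u, i) ∈ S then (1 : ℝ) else 0) := by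
    rw [← Finset.sum_pos_iff_of_nonneg fun S _ => hnn S, hμ.sum_mem (u, i)]
    exact hpos
  have hmem : (u, i) ∈ S := by
    by_contra h
    simp [h] at hS
  rw [if_pos hmem, mul_one] at hS
  have hne : expand x S i ≠ x := fun h => hi (by simpa [expand, hmem] using congr_fun h u)
  refine sub_pos.1 (lt_of_lt_of_le ?_ (hμ.sum_objective_expand_le hz1 G c hw x))
  refine Finset.sum_pos' (fun S _ => mul_nonneg (hμ.nonneg S)
    (Finset.sum_nonneg fun i _ => hx.le_expand hw S i)) ⟨S, Finset.mem_univ S, mul_pos hS ?_⟩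
  exact Finset.sum_pos' (fun i _ => hx.le_expand hw S i) ⟨i, Finset.mem_univ i,
    sub_pos.2 (hx _ (isPerturbation_worstWeight hw x) _ (isExpansion_expand hne))⟩

lemma BeatsExpansions.eq_of_isMAP (hx : BeatsExpansions G c w x)
    (hw : ∀ e ∈ G.edgeSet, 0 ≤ w e) {y : V → Fin k} (hy : IsMAP G c w y) : y = x := by
  by_contra hne
  obtain ⟨u, hu⟩ := Function.ne_iff.1 hne
  have h := hx.objective_lt hw (z := nodeVector y)
    (fun u i => by unfold nodeVector; split_ifs <;> simp) (fun u => by simp [nodeVector]) hu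
    (by simp [nodeVector])
  rw [relaxedObjective_nodeVector] at h
  exact absurd (hy x) (not_le.2 h)

end Tight

end Expansion

section Curvature

variable [Fintype V]

/-! ### Curvature of the local LP around the latent MAP solution -/

/-- The node costs `c` with the costs of the labels used by `x` raised by `t`. -/
def raise (c : V → Fin k → ℝ) (x : V → Fin k) (t : ℝ) : V → Fin k → ℝ :=
  fun u i => c u i + if x u = i then t else 0

lemma relaxedObjective_raise (G : SimpleGraph V) [DecidableRel G.Adj] (c : V → Fin k → ℝ)
    (w : Sym2 V → ℝ) (x : V → Fin k) (t : ℝ) (z : V → Fin k → ℝ) :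
    relaxedObjective G (raise c x t) w z = relaxedObjective G c w z + t * ∑ u, z u (x u) := by
  simp only [relaxedObjective, raise, add_mul, Finset.sum_add_distrib, ite_mul, zero_mul,
    Finset.sum_ite_eq, Finset.mem_univ, if_true, ← Finset.mul_sum]
  ring

lemma objective_raise (G : SimpleGraph V) [DecidableRel G.Adj] (c : V → Fin k → ℝ)
    (w : Sym2 V → ℝ) (x : V → Fin k) (t : ℝ) (y : V → Fin k) :
    objective G (raise c x t) w y =
      objective G c w y + t * (Fintype.card V - hammingDist x y) := by
  rw [← relaxedObjective_nodeVector, relaxedObjective_raise, relaxedObjective_nodeVector]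
  congr 2
  have : (Fintype.card V : ℝ) = (∑ u, if x u = y u then (1 : ℝ) else 0) + hammingDist x y := by
    rw [hammingDist, Finset.sum_boole, ← Finset.card_univ, ← Nat.cast_add,
      Finset.card_filter_add_card_filter_not]
  rw [this]
  simp [nodeVector, eq_comm]

lemma half_l1Dist_nodeVector {z : V → Fin k → ℝ} (hz : ∀ u i, z u i ∈ Set.Icc (0 : ℝ) 1)
    (hz1 : ∀ u, ∑ i, z u i = 1) (x : V → Fin k) :
    1 / 2 * l1Dist z (nodeVector x) = Fintype.card V - ∑ u, z u (x u) := by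
  have h : ∀ u, ∑ i, |z u i - nodeVector x u i| = 2 * (1 - z u (x u)) := by
    intro u
    have h1 : ∀ i, |z u i - nodeVector x u i| = z u i + if x u = i then 1 - 2 * z u i else 0 := by
      intro i
      unfold nodeVector
      split_ifs
      · rw [abs_of_nonpos (by linarith [(hz u i).2])]; ring
      · simpa using (hz u i).1
    simp only [h1, Finset.sum_add_distrib, hz1, Finset.sum_ite_eq, Finset.mem_univ, if_true]
    ring
  simp only [l1Dist, h, ← Finset.mul_sum, Finset.sum_sub_distrib, Finset.sum_const,
    Finset.card_univ, nsmul_eq_mul]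
  ring

variable {G : SimpleGraph V} [DecidableRel G.Adj] {c : V → Fin k → ℝ}
  {w : Sym2 V → ℝ} {x : V → Fin k} {ψ : ℝ}

lemma PsiExpansionStable.raise (h : PsiExpansionStable G c w ψ) {t : ℝ} (ht : t ∈ Set.Icc 0 ψ) :
    ExpansionStable G (raise c x t) w := by
  refine h _ fun u i => ?_
  unfold Potts.raise
  have := ht.1
  have := ht.2
  split_ifs <;> constructor <;> linarith

variable [DecidableEq V]

/-- Raising by t lowers the gap of y over x at rate `hammingDist x y`. If x lost optimality by time
ψ, then at the first tie the raised instance would have two MAP solutions, whereas a stable instance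
has only one. -/
lemma PsiExpansionStable.isMAP_raise (h : PsiExpansionStable G c w ψ)
    (hw : ∀ e ∈ G.edgeSet, 0 ≤ w e) (hx : IsMAP G c w x) : IsMAP G (Potts.raise c x ψ) w x := by
  by_contra hcon
  unfold IsMAP at hcon
  push Not at hcon
  obtain ⟨y, hy⟩ := hcon
  have hraise : ∀ t y, objective G (Potts.raise c x t) w y - objective G (Potts.raise c x t) w x =
      objective G c w y - objective G c w x - t * hammingDist x y := by
    intro t y
    rw [objective_raise, objective_raise, hammingDist_self]
    push_cast
    ring
  have hgap : ∀ y, 0 ≤ objective G c w y - objective G c w x := fun y => sub_nonneg.2 (hx y)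
  have hpos : 0 < hammingDist x y := by
    rw [Nat.pos_iff_ne_zero]
    intro h0
    have := hraise ψ y
    rw [h0, Nat.cast_zero, mul_zero] at this
    linarith [hgap y]
  -- The ratio is the value of t at which y ties with x; s is the first labeling to do so.
  obtain ⟨s, hs, hmin⟩ := Finset.exists_min_image
    (Finset.univ.filter fun y : V → Fin k => 0 < hammingDist x y)
    (fun y => (objective G c w y - objective G c w x) / hammingDist x y) ⟨y, by simpa using hpos⟩
  simp only [Finset.mem_filter, Finset.mem_univ, true_and] at hs hmin
  set t := (objective G c w s - objective G c w x) / hammingDist x s with ht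
  have ht0 : 0 ≤ t := div_nonneg (hgap s) (Nat.cast_nonneg _)
  have htψ : t ≤ ψ := by
    refine (hmin y hpos).trans ?_
    rw [div_le_iff₀ (Nat.cast_pos.2 hpos)]
    linarith [hraise ψ y]
  have hmap : IsMAP G (Potts.raise c x t) w x := by
    intro y
    rw [← sub_nonneg, hraise]
    rcases Nat.eq_zero_or_pos (hammingDist x y) with h0 | h0
    · rw [h0, Nat.cast_zero, mul_zero, sub_zero]
      exact hgap y
    · have := hmin y h0
      rw [le_div_iff₀ (Nat.cast_pos.2 h0)] at this
      linarith
  have hmap' : IsMAP G (Potts.raise c x t) w s := by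
    have heq : objective G (Potts.raise c x t) w s = objective G (Potts.raise c x t) w x := by
      rw [← sub_eq_zero, hraise, ht, div_mul_cancel₀ _ (Nat.cast_pos.2 hs).ne', sub_self]
    intro y
    rw [heq]
    exact hmap y
  obtain ⟨x', -, hbeats⟩ := h.raise (x := x) ⟨ht0, htψ⟩
  have hsx : s = x := ((show BeatsExpansions G _ w x' from hbeats).eq_of_isMAP hw hmap').trans
    ((show BeatsExpansions G _ w x' from hbeats).eq_of_isMAP hw hmap).symm
  rw [hsx, hammingDist_self] at hs
  exact lt_irrefl 0 hs

/-- Tightness at the full raise ψ: the raise charges x for every vertex but z only for the mass it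
shares with x, and the difference is ψ times half the ℓ₁ distance. -/
lemma PsiExpansionStable.le_relaxedObjective_sub (h : PsiExpansionStable G c w ψ) (hψ : 0 < ψ)
    (hw : ∀ e ∈ G.edgeSet, 0 ≤ w e) (hx : IsMAP G c w x) {z : V → Fin k → ℝ}
    (hz : ∀ u i, z u i ∈ Set.Icc (0 : ℝ) 1) (hz1 : ∀ u, ∑ i, z u i = 1) :
    ψ * (1 / 2 * l1Dist z (nodeVector x)) ≤ relaxedObjective G c w z - objective G c w x := by
  obtain ⟨x', -, hbeats⟩ := h.raise (x := x) ⟨hψ.le, le_rfl⟩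
  change BeatsExpansions G _ w x' at hbeats
  obtain rfl := hbeats.eq_of_isMAP hw (h.isMAP_raise hw hx)
  have := hbeats.objective_le hw hz hz1
  rw [relaxedObjective_raise, objective_raise, hammingDist_self] at this
  rw [half_l1Dist_nodeVector hz hz1]
  push_cast at this
  linarith

/-- If a solution of a perturbed local LP is far from the MAP solution of a stable instance, then
some `0/1` node vector gains as much from the perturbation. -/
lemma PsiExpansionStable.exists_setVector (h : PsiExpansionStable G c w ψ) (hψ : 0 < ψ)
    (hw : ∀ e ∈ G.edgeSet, 0 ≤ w e) (hx : IsMAP G c w x) {c' : V → Fin k → ℝ} {w' : Sym2 V → ℝ}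
    (hw' : ∀ e ∈ G.edgeSet, 0 ≤ w e + w' e) {y : LocalPoint V k}
    (hy : IsLPSolution G (fun u i => c u i + c' u i) (fun e => w e + w' e) y) :
    ∃ S : Finset (V × Fin k), ψ * (1 / 2 * l1Dist y.node (nodeVector x)) ≤
      relaxedObjective G c' w' (nodeVector x) - relaxedObjective G c' w' (setVector S) := by
  have h1 := h.le_relaxedObjective_sub hψ hw hx hy.1.node_mem hy.1.normalized
  have h2 := (hy.1.relaxedObjective_le (fun u i => c u i + c' u i) hw').trans
    (hy.2 _ (integralPoint_feasible G x))
  rw [lpObjective_integralPoint, ← relaxedObjective_nodeVector, relaxedObjective_add,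
    relaxedObjective_add, relaxedObjective_nodeVector] at h2
  obtain ⟨μ, hμ⟩ := exists_isThresholdMixture (fun p : V × Fin k => y.node p.1 p.2)
    fun p => hy.1.node_mem p.1 p.2
  by_contra hcon
  push Not at hcon
  have h3 : ∑ S, μ S * (relaxedObjective G c' w' (nodeVector x)
      - relaxedObjective G c' w' (setVector S)) =
      relaxedObjective G c' w' (nodeVector x) - relaxedObjective G c' w' y.node := by
    simp only [mul_sub, Finset.sum_sub_distrib, hμ.sum_relaxedObjective, ← Finset.sum_mul,
      hμ.sum_eq_one, one_mul]
  have h4 : ∑ S, μ S * (relaxedObjective G c' w' (nodeVector x)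
      - relaxedObjective G c' w' (setVector S)) <
      ∑ S, μ S * (ψ * (1 / 2 * l1Dist y.node (nodeVector x))) := by
    obtain ⟨S, hS, hS0⟩ := (Finset.sum_pos_iff_of_nonneg fun S _ => hμ.nonneg S).1
      (hμ.sum_eq_one.symm ▸ zero_lt_one)
    exact Finset.sum_lt_sum (fun S _ => mul_le_mul_of_nonneg_left (hcon S).le (hμ.nonneg S))
      ⟨S, hS, mul_lt_mul_of_pos_left (hcon S) hS0⟩
  rw [h3, ← Finset.sum_mul, hμ.sum_eq_one, one_mul] at h4
  linarith

end Curvature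

section Noise

/-! ### Concentration of the noise -/

lemma hasSubgaussianMGF_mono {Ω : Type*} [MeasurableSpace Ω] {P : Measure Ω} {X : Ω → ℝ}
    {a b : ℝ≥0} (h : HasSubgaussianMGF X a P) (hab : a ≤ b) : HasSubgaussianMGF X b P where
  integrable_exp_mul := h.integrable_exp_mul
  mgf_le t := (h.mgf_le t).trans <| Real.exp_le_exp.2 <| by
    have : (a : ℝ) ≤ b := hab
    gcongr

/-- A Chernoff bound which also covers degenerate variables. -/
lemma measure_lt_le_of_hasSubgaussianMGF {Ω : Type*} [MeasurableSpace Ω] {P : Measure Ω}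
    [IsProbabilityMeasure P] {X : Ω → ℝ} {v : ℝ≥0} (h : HasSubgaussianMGF X v P) {ε r : ℝ}
    (hε : 0 ≤ ε) (hr : 2 * v * r ≤ ε ^ 2) :
    P {ω | ε < X ω} ≤ ENNReal.ofReal (Real.exp (-r)) := by
  -- With v = 0 the Chernoff exponent is a division by zero and gives only the trivial bound 1. The
  -- variable is then almost surely 0, and the strict inequality makes the event null.
  rcases eq_or_ne v 0 with rfl | hv
  · have : P {ω | ε < X ω} = 0 := by
      refine measure_mono_null ?_ (ae_iff.1 h.ae_eq_zero_of_hasSubgaussianMGF_zero)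
      intro ω hω
      exact (hε.trans_lt hω).ne'
    rw [this]
    exact zero_le
  · have hv' : (0 : ℝ) < v := NNReal.coe_pos.2 (pos_iff_ne_zero.2 hv)
    refine (measure_mono (t := {ω | ε ≤ X ω}) fun ω (hω : ε < X ω) => hω.le).trans ?_
    rw [← ofReal_measureReal]
    refine ENNReal.ofReal_le_ofReal ((h.measure_ge_le hε).trans (Real.exp_le_exp.2 ?_))
    rw [neg_div, neg_le_neg_iff, le_div_iff₀ (by positivity)]
    linarith

variable [DecidableEq V]

lemma abs_nodeVector_sub_setVector_le (x : V → Fin k) (S : Finset (V × Fin k)) (u : V)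
    (i : Fin k) : |nodeVector x u i - setVector S u i| ≤ 1 := by
  unfold nodeVector setVector
  split_ifs <;> norm_num

/-- The set vector is not normalized, so its uniform distance can reach k/2 rather than 1; with at
least two labels this also covers the cut indicator. It is the source of the factor k in the edge
part of the bound. -/
lemma abs_labelDist_sub_le (hk : 2 ≤ k) (x : V → Fin k) (S : Finset (V × Fin k)) (e : Sym2 V) :
    |labelDist (nodeVector x) e - labelDist (setVector S) e| ≤ k / 2 := by
  have hk' : (2 : ℝ) ≤ k := by exact_mod_cast hk
  have h1 : 0 ≤ cut x e ∧ cut x e ≤ 1 := by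
    unfold cut
    split_ifs <;> norm_num
  have h2 : 0 ≤ labelDist (setVector S) e ∧ labelDist (setVector S) e ≤ k / 2 := by
    induction e with | _ u v
    rw [labelDist_mk]
    have h3 : ∑ i, |setVector S u i - setVector S v i| ≤ ∑ _i : Fin k, (1 : ℝ) := by
      refine Finset.sum_le_sum fun i _ => ?_
      unfold setVector
      split_ifs <;> norm_num
    rw [Finset.sum_const, Finset.card_univ, Fintype.card_fin, nsmul_one] at h3
    exact ⟨by positivity, by linarith⟩
  rw [labelDist_nodeVector, abs_le]
  constructor <;> linarith

variable {Ω : Type*} [MeasurableSpace Ω] {P : Measure Ω} {G : SimpleGraph V}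
  {w : Sym2 V → ℝ} {N : Finset (V × Fin k)} {M : Finset (Sym2 V)} {σ γ : ℝ≥0}
  {cn : V → Fin k → Ω → ℝ} {wn : Sym2 V → Ω → ℝ}

lemma NoiseModel.cost_hasSubgaussianMGF [IsProbabilityMeasure P]
    (h : NoiseModel G w N M σ γ P cn wn) (u : V) (i : Fin k) :
    HasSubgaussianMGF (cn u i) (if (u, i) ∈ N then σ ^ 2 else 0) P := by
  split_ifs with hN
  · simpa [SubGaussian, h.cost_mean u i hN] using h.cost_subGaussian u i hN
  · refine HasSubgaussianMGF.fun_zero.congr ?_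
    filter_upwards [h.cost_clean u i hN] with ω hω
    exact hω.symm

lemma NoiseModel.weight_hasSubgaussianMGF [IsProbabilityMeasure P]
    (h : NoiseModel G w N M σ γ P cn wn) {e : Sym2 V} (he : e ∈ G.edgeSet) :
    HasSubgaussianMGF (wn e) (if e ∈ M then γ ^ 2 else 0) P := by
  split_ifs with hM
  · simpa [SubGaussian, h.weight_mean e hM] using (h.weight_subGaussian e hM).2
  · refine HasSubgaussianMGF.fun_zero.congr ?_
    filter_upwards [h.weight_clean e he hM] with ω hω
    exact hω.symm

variable [Fintype V]

lemma NoiseModel.ae_weight_nonneg (h : NoiseModel G w N M σ γ P cn wn)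
    (hw : ∀ e ∈ G.edgeSet, 0 ≤ w e) : ∀ᵐ ω ∂P, ∀ e ∈ G.edgeSet, 0 ≤ w e + wn e ω := by
  rw [ae_all_iff]
  intro e
  by_cases he : e ∈ G.edgeSet
  · by_cases hM : e ∈ M
    · filter_upwards [(h.weight_subGaussian e hM).1] with ω hω _
      linarith
    · filter_upwards [h.weight_clean e he hM] with ω hω _
      rw [hω, add_zero]
      exact hw e he
  · exact ae_of_all _ fun ω h => absurd h he

/-- The gain of a `0/1` node vector over a labeling from the noise is sub-Gaussian. -/
lemma NoiseModel.hasSubgaussianMGF_gap [IsProbabilityMeasure P] [DecidableRel G.Adj]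
    (h : NoiseModel G w N M σ γ P cn wn) (hM : M ⊆ G.edgeFinset) (hk : 2 ≤ k) (x : V → Fin k)
    (S : Finset (V × Fin k)) :
    HasSubgaussianMGF (fun ω =>
      relaxedObjective G (fun u i => cn u i ω) (fun e => wn e ω) (nodeVector x)
        - relaxedObjective G (fun u i => cn u i ω) (fun e => wn e ω) (setVector S))
      (N.card * σ ^ 2 + M.card * ((k / 2) ^ 2 * γ ^ 2)) P := by
  let a : (V × Fin k) ⊕ G.edgeSet → ℝ := Sum.elim
    (fun p => nodeVector x p.1 p.2 - setVector S p.1 p.2)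
    (fun e => labelDist (nodeVector x) e - labelDist (setVector S) e)
  let X : (V × Fin k) ⊕ G.edgeSet → Ω → ℝ := Sum.elim (fun p => cn p.1 p.2) (fun e => wn e)
  let b : (V × Fin k) ⊕ G.edgeSet → ℝ≥0 := Sum.elim
    (fun p => if p ∈ N then σ ^ 2 else 0)
    (fun e => (k / 2) ^ 2 * if (e : Sym2 V) ∈ M then γ ^ 2 else 0)
  have hind : iIndepFun (fun j ω => a j * X j ω) P :=
    h.indep.comp (fun j t => a j * t) fun j => measurable_const_mul (a j)
  have hsub : ∀ j ∈ Finset.univ, HasSubgaussianMGF (fun ω => a j * X j ω) (b j) P := by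
    rintro (⟨u, i⟩ | ⟨e, he⟩) -
    · refine hasSubgaussianMGF_mono ((h.cost_hasSubgaussianMGF u i).const_mul _)
        (mul_le_of_le_one_left zero_le ?_)
      exact (sq_le_one_iff_abs_le_one _).2 (abs_nodeVector_sub_setVector_le x S u i)
    · refine hasSubgaussianMGF_mono ((h.weight_hasSubgaussianMGF he).const_mul _)
        (mul_le_mul_of_nonneg_right ?_ zero_le)
      change _ ≤ (((k / 2 : ℝ≥0) ^ 2 : ℝ≥0) : ℝ)
      push_cast
      exact sq_le_sq' (abs_le.1 (abs_labelDist_sub_le hk x S e)).1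
        (abs_le.1 (abs_labelDist_sub_le hk x S e)).2
  convert HasSubgaussianMGF.sum_of_iIndepFun hind hsub using 1
  · funext ω
    rw [Fintype.sum_sum_type, Fintype.sum_prod_type]
    simp only [a, X, Sum.elim_inl, Sum.elim_inr, relaxedObjective]
    have hE : ∀ f : Sym2 V → ℝ, ∑ e ∈ G.edgeFinset, f e = ∑ e : G.edgeSet, f e := fun f =>
      Finset.sum_subtype _ (fun e => SimpleGraph.mem_edgeFinset) f
    rw [hE, hE]
    simp only [sub_mul, Finset.sum_sub_distrib, mul_comm (cn _ _ ω), mul_comm (wn _ ω)]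
    ring
  · rw [Fintype.sum_sum_type]
    simp only [b, Sum.elim_inl, Sum.elim_inr]
    have hE : ∑ e : G.edgeSet, ((k : ℝ≥0) / 2) ^ 2 * (if (e : Sym2 V) ∈ M then γ ^ 2 else 0) =
        ∑ e ∈ G.edgeFinset, ((k : ℝ≥0) / 2) ^ 2 * (if e ∈ M then γ ^ 2 else 0) :=
      (Finset.sum_subtype _ (fun e => SimpleGraph.mem_edgeFinset)
        fun e => ((k : ℝ≥0) / 2) ^ 2 * (if e ∈ M then γ ^ 2 else 0)).symm
    rw [hE, ← Finset.mul_sum, ← Finset.sum_filter, ← Finset.sum_filter,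
      Finset.filter_mem_eq_inter, Finset.filter_mem_eq_inter, Finset.univ_inter,
      Finset.inter_eq_right.2 hM]
    simp only [Finset.sum_const, nsmul_eq_mul]
    ring

end Noise

end Potts

/-! ### The recovery bound by a union over 0/1 vectors. -/

theorem mainTheorem5 {V : Type*} [Fintype V] [DecidableEq V] {k d : ℕ}
    (G : SimpleGraph V) [DecidableRel G.Adj] (hG : G.IsRegularOfDegree d)
    -- the latent stable instance and its MAP solution
    (cbar : V → Fin k → ℝ) (wbar : Sym2 V → ℝ) (hw : ∀ e ∈ G.edgeSet, 0 ≤ wbar e)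
    {ψ : ℝ} (hψ : 0 < ψ) (hstable : Potts.PsiExpansionStable G cbar wbar ψ)
    (xbar : V → Fin k) (hxbar : Potts.IsMAP G cbar wbar xbar)
    -- a fraction `ρ` of the node costs and a fraction `η` of the edge weights are noised
    (N : Finset (V × Fin k)) (M : Finset (Sym2 V)) (hM : M ⊆ G.edgeFinset) {ρ η : ℝ}
    (hρ : (N.card : ℝ) = ρ * (Fintype.card V * k))
    (hη : (M.card : ℝ) = η * G.edgeFinset.card)
    {Ω : Type*} [MeasurableSpace Ω] (P : MeasureTheory.Measure Ω)
    [MeasureTheory.IsProbabilityMeasure P] (σ γ : NNReal)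
    (cn : V → Fin k → Ω → ℝ) (wn : Sym2 V → Ω → ℝ)
    (hnoise : Potts.NoiseModel G wbar N M σ γ P cn wn)
    (C : ℝ) (hC : Real.sqrt (Real.log 2) < C) :
    -- the event that some solution of the observed local LP violates the recovery bound
    P {ω | ∃ xhat : Potts.LocalPoint V k,
        Potts.IsLPSolution G (fun u i => cbar u i + cn u i ω) (fun e => wbar e + wn e ω) xhat ∧
        2 * C * Fintype.card V * k *
            Real.sqrt (ρ * (σ : ℝ) ^ 2 + η * d * k * (γ : ℝ) ^ 2 / 8) / ψ <
          1 / 2 * Potts.l1Dist xhat.node (Potts.nodeVector xbar)}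
      ≤ ENNReal.ofReal
          (2 * Real.exp (-((Fintype.card V : ℝ) * k * (C ^ 2 - Real.log 2)))) := by
  have hC0 : 0 ≤ C := (Real.sqrt_nonneg _).trans hC.le
  set n : ℝ := (Fintype.card V : ℝ) with hn
  set s := ρ * (σ : ℝ) ^ 2 + η * d * k * (γ : ℝ) ^ 2 / 8 with hs
  have hε : 0 ≤ 2 * C * n * k * Real.sqrt s := by positivity
  -- Here all feasible points share one node vector, so the distance is 0 and the event is empty.
  by_cases hdeg : IsEmpty V ∨ k < 2
  · have hempty : {ω | ∃ xhat : Potts.LocalPoint V k,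
        Potts.IsLPSolution G (fun u i => cbar u i + cn u i ω) (fun e => wbar e + wn e ω) xhat ∧
        2 * C * n * k * Real.sqrt s / ψ <
          1 / 2 * Potts.l1Dist xhat.node (Potts.nodeVector xbar)} = ∅ := by
      refine Set.eq_empty_of_forall_notMem fun ω ⟨y, hy, hlt⟩ => ?_
      have h1 : ∀ u, y.node u (xbar u) = 1 := by
        intro u
        rcases hdeg with h | h
        · exact h.elim u
        · have : Subsingleton (Fin k) := Fin.subsingleton_iff_le_one.2 (by omega)
          rw [← hy.1.normalized u, Fintype.sum_subsingleton _ (xbar u)]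
      rw [Potts.half_l1Dist_nodeVector hy.1.node_mem hy.1.normalized] at hlt
      simp only [h1, Finset.sum_const, Finset.card_univ, nsmul_one, sub_self] at hlt
      exact absurd hlt (not_lt.2 (div_nonneg hε hψ.le))
    rw [hempty, MeasureTheory.measure_empty]
    exact zero_le
  · push Not at hdeg
    obtain ⟨hV, hk⟩ := hdeg
    have hnpos : 0 < n := Nat.cast_pos.2 Fintype.card_pos
    have hkpos : (0 : ℝ) < k := Nat.cast_pos.2 (by omega)
    let v : NNReal := N.card * σ ^ 2 + M.card * ((k / 2) ^ 2 * γ ^ 2)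
    have hdegsum : n * d = 2 * (G.edgeFinset.card : ℝ) := by
      have h := G.sum_degrees_eq_twice_card_edges
      simp only [hG.degree_eq, Finset.sum_const, Finset.card_univ, smul_eq_mul] at h
      rw [hn]
      exact_mod_cast h
    -- The edges contribute η|E|(k/2)²γ², and |E| = nd/2 turns this into nk · ηdkγ²/8.
    have hv : (v : ℝ) = n * k * s := by
      simp only [v, NNReal.coe_add, NNReal.coe_mul, NNReal.coe_pow, NNReal.coe_natCast,
        NNReal.coe_div, NNReal.coe_ofNat]
      rw [hρ, hη, hs]
      linear_combination (- η * k ^ 2 * (γ : ℝ) ^ 2 / 8) * hdegsum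
    -- The signs of ρ and η are not given directly; nonnegativity comes from the variance proxy v.
    have hs0 : 0 ≤ s := by
      have h : 0 ≤ n * k * s := hv ▸ v.2
      exact nonneg_of_mul_nonneg_right h (by positivity)
    let gap : Finset (V × Fin k) → Ω → ℝ := fun S ω =>
      Potts.relaxedObjective G (fun u i => cn u i ω) (fun e => wn e ω) (Potts.nodeVector xbar)
        - Potts.relaxedObjective G (fun u i => cn u i ω) (fun e => wn e ω) (Potts.setVector S)
    have htail : ∀ S, P {ω | 2 * C * n * k * Real.sqrt s < gap S ω} ≤
        ENNReal.ofReal (Real.exp (-(2 * C ^ 2 * (n * k)))) := by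
      intro S
      refine Potts.measure_lt_le_of_hasSubgaussianMGF
        (hnoise.hasSubgaussianMGF_gap hM hk xbar S) hε ?_
      change 2 * (v : ℝ) * _ ≤ _
      rw [hv, mul_pow, Real.sq_sqrt hs0]
      -- The threshold is chosen so that its square is exactly 2 · (nks) · (2C²nk).
      exact le_of_eq (by ring)
    calc _ ≤ P (⋃ S, {ω | 2 * C * n * k * Real.sqrt s < gap S ω}) := by
          -- The inclusion is only almost sure, since truncation keeps the observed weights
          -- nonnegative almost surely.
          refine MeasureTheory.measure_mono_ae ?_
          filter_upwards [hnoise.ae_weight_nonneg hw] with ω hω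
          rintro ⟨y, hy, hlt⟩
          obtain ⟨S, hS⟩ := hstable.exists_setVector hψ hw hxbar hω hy
          rw [div_lt_iff₀ hψ, mul_comm _ ψ] at hlt
          exact Set.mem_iUnion.2 ⟨S, hlt.trans_le hS⟩
      _ ≤ ∑ S, P {ω | 2 * C * n * k * Real.sqrt s < gap S ω} :=
          MeasureTheory.measure_iUnion_fintype_le _ _
      _ ≤ ∑ _S : Finset (V × Fin k), ENNReal.ofReal (Real.exp (-(2 * C ^ 2 * (n * k)))) :=
          Finset.sum_le_sum fun S _ => htail S
      _ = ENNReal.ofReal (2 ^ (Fintype.card V * k) * Real.exp (-(2 * C ^ 2 * (n * k)))) := by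
          rw [← ENNReal.ofReal_sum_of_nonneg fun _ _ => (Real.exp_pos _).le, Finset.sum_const,
            Finset.card_univ, Fintype.card_finset, Fintype.card_prod, Fintype.card_fin,
            nsmul_eq_mul]
          push_cast
          rfl
      _ ≤ _ := by
          refine ENNReal.ofReal_le_ofReal ?_
          have h2 : (2 : ℝ) ^ (Fintype.card V * k) = Real.exp (n * k * Real.log 2) := by
            rw [← Real.exp_log (show (0 : ℝ) < 2 by norm_num), ← Real.exp_nat_mul,
              Real.log_exp]
            push_cast
            rfl
          rw [h2, ← Real.exp_add]
          -- The union bound gives exponent nk(log 2 - 2C²); dropping one C²nk, and allowing the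
          -- factor 2, leaves the stated form.
          have h3 : 0 ≤ C ^ 2 * (n * k) := by positivity
          have h4 : n * k * Real.log 2 + -(2 * C ^ 2 * (n * k)) ≤
              -(n * k * (C ^ 2 - Real.log 2)) := by linarith
          linarith [Real.exp_le_exp.2 h4, Real.exp_pos (-(n * k * (C ^ 2 - Real.log 2)))]
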